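/- **Model.** Let $N$ agents share an environment with a measurable state space $\mathcal S$ (for instance a topological space with its Borel $\sigma$-algebra), a countable discrete joint-observation space $\mathcal O=\mathcal O^0\times\prod_{n=1}^N\mathcal O^n$ (common component and private components), and a finite joint-action space $\mathcal A=\prod_{n=1}^N\mathcal A^n$. Let $P_1$ be a probability measure on $\mathcal S\times\mathcal O$ (the law of the initial state and joint observation) and let $P_{tr}$ be a transition probability kernel from $\mathcal S\times\mathcal A$ to $\mathcal S\times\mathcal O$ (the time-homogeneous law of the next state and joint observation given the current state and joint action). For $t\in\{1,2,\dots\}$, the joint history is $h_t=(o_{1:t},a_{1:t-1})\in\mathcal H_t=\mathcal O^t\times\mathcal A^{t-1}$, and the part of it known to agent $n$ is $h_t^{0,n}=(o^0_{1:t},o^n_{1:t},a^n_{1:t-1})\in\mathcal H_t^{0,n}$ (actions are private). **Policies.** A behavioral policy of agent $n$ is a sequence $u^n=(u^n_t)_{t\ge1}$ of maps $u^n_t:\mathcal H_t^{0,n}\to M_1(\mathcal A^n)$, where $M_1(X)$ denotes the set of Borel probability measures on $X$. Let $\mathcal U^n$ be the set of these policies, with the product topology of $\prod_t\prod_{h\in\mathcal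 H^{0,n}_t}M_1(\mathcal A^n)$ and its Borel $\sigma$-algebra. Let $\mathcal U^n_{\mathrm{pure}}\subseteq\mathcal U^n$ be the subspace of pure policies, i.e. those for which every $u^n_t(h)$ is a Dirac measure. Let $\mathcal U=\prod_{n=1}^N\mathcal U^n$ be the set of decentralized behavioral policy-profiles. For $u\in\mathcal U$ let $\mathbb P^u$ be the law on $(\mathcal S\times\mathcal O\times\mathcal A)^\infty$ (given by the Ionescu-Tulcea theorem) of the process $(S_t,O_t,A_t)_{t\ge1}$ in which $(S_1,O_1)\sim P_1$, $(S_{t+1},O_{t+1})\sim P_{tr}(\cdot\mid S_t,A_t)$, and, given the past, $S_t$ and $O_t$, the agents draw their actions independently, $A_t\sim\bigotimes_{n=1}^N u^n_t(H_t^{0,n})$. For $\mu\in M_1(\mathcal U)$ let $\mathbb P^\mu$ be the law on $\mathcal U\times(\mathcal S\times\mathcal O\times\mathcal A)^\infty$ obtained by first drawing a random profile $U\sim\mu$ and then running the process with law $\mathbb P^U$. **Occupation measures.** For $x\in\mathcal U$ or $x\in M_1(\mathcal U)$ the (infinite-horizon, undiscounted) occupation measure of $x$ is the family $$\mathrm{om}(x)=\big(\mathbb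 P^x(H_t=h_t,\,A_t=a_t)\;:\;t\ge1,\ h_t\in\mathcal H_t,\ a_t\in\mathcal A\big),$$ and $\mathrm{om}(X)=\{\mathrm{om}(x):x\in X\}$. Elements $(\mu^1,\dots,\mu^N)$ of $\prod_n M_1(\mathcal U^n)$ and of $\prod_n M_1(\mathcal U^n_{\mathrm{pure}})$ are identified with the product measures $\mu^1\otimes\dots\otimes\mu^N$, regarded as elements of $M_1(\mathcal U)$. **Theorem.** For every such model, $$\mathrm{om}(\mathcal U)=\mathrm{om}\Big(\prod_{n=1}^N M_1(\mathcal U^n)\Big)=\mathrm{om}\Big(\prod_{n=1}^N M_1(\mathcal U^n_{\mathrm{pure}})\Big).$$ -/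

import Mathlib

open MeasureTheory ProbabilityTheory
open scoped ENNReal

namespace DecPOMDP

section Spaces

variable {N : ℕ}

/-- Joint observations: one common component and one private component per agent. -/
abbrev JointObs (O₀ : Type*) (O : Fin N → Type*) := O₀ × (∀ n, O n)

/-- Joint actions: one component per agent. -/
abbrev JointAct (A : Fin N → Type*) := ∀ n, A n

/-- What happens at one time step: state, joint observation, joint action. -/
abbrev Stage (S O₀ : Type*) (O A : Fin N → Type*) := S × JointObs O₀ O × JointAct A

/-- Joint histories at time `t` (time starts at `0`): the joint observations at the times `0, …, t`
and the joint actions at the times `0, …, t - 1`. -/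
abbrev JointHist (O₀ : Type*) (O A : Fin N → Type*) (t : ℕ) :=
  (Fin (t + 1) → JointObs O₀ O) × (Fin t → JointAct A)

/-- Histories of agent `n` at time `t`: common observations and her private observations at the
times `0, …, t`, and her own actions at the times `0, …, t - 1`. -/
abbrev AgentHist (O₀ : Type*) (O A : Fin N → Type*) (n : Fin N) (t : ℕ) :=
  (Fin (t + 1) → O₀) × (Fin (t + 1) → O n) × (Fin t → A n)

/-- The part of a joint history that agent `n` knows. -/
def JointHist.agent {O₀ : Type*} {O A : Fin N → Type*} {t : ℕ} (h : JointHist O₀ O A t)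
    (n : Fin N) : AgentHist O₀ O A n t :=
  (fun i => (h.1 i).1, fun i => (h.1 i).2 n, fun i => h.2 i n)

/-- Behavioral policies of agent `n`: at each time, a map from her histories to probability
measures on her actions. Histories are countable and discrete, so every such map is measurable. -/
abbrev Policy (O₀ : Type*) (O A : Fin N → Type*) [∀ n, MeasurableSpace (A n)] (n : Fin N) :=
  ∀ t : ℕ, AgentHist O₀ O A n t → ProbabilityMeasure (A n)

/-- Decentralized behavioral policy-profiles. -/
abbrev Profile (O₀ : Type*) (O A : Fin N → Type*) [∀ n, MeasurableSpace (A n)] :=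
  ∀ n, Policy O₀ O A n

/-- A policy is pure if each of its decision rules only takes values that are Dirac measures. -/
def IsPure {O₀ : Type*} {O A : Fin N → Type*} [∀ n, MeasurableSpace (A n)] {n : Fin N}
    (u : Policy O₀ O A n) : Prop :=
  ∀ t h, ∃ a : A n, (u t h : Measure (A n)) = Measure.dirac a

/-- Pure policies of agent `n`, with the subspace `σ`-algebra. -/
abbrev PurePolicy (O₀ : Type*) (O A : Fin N → Type*) [∀ n, MeasurableSpace (A n)] (n : Fin N) :=
  {u : Policy O₀ O A n // IsPure u}

/-- The joint history at time `t + 1` from the stages up to time `t` and the joint observation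
at time `t + 1`. -/
def nextHist {S O₀ : Type*} {O A : Fin N → Type*} {t : ℕ} (x : (i : Finset.Iic t) → Stage S O₀ O A) (o : JointObs O₀ O) :
    JointHist O₀ O A (t + 1) :=
  (Fin.snoc (α := fun _ => JointObs O₀ O)
      (fun i : Fin (t + 1) => (x ⟨i, Finset.mem_Iic.2 (Nat.lt_succ_iff.1 i.2)⟩).2.1) o,
    fun i : Fin (t + 1) => (x ⟨i, Finset.mem_Iic.2 (Nat.lt_succ_iff.1 i.2)⟩).2.2)

theorem measurable_nextHist {S O₀ : Type*} {O A : Fin N → Type*} [MeasurableSpace S]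
    [MeasurableSpace O₀] [∀ n, MeasurableSpace (O n)] [∀ n, MeasurableSpace (A n)] (t : ℕ) :
    Measurable fun p : ((i : Finset.Iic t) → Stage S O₀ O A) × JointObs O₀ O =>
      nextHist p.1 p.2 := by
  refine Measurable.prodMk (measurable_pi_lambda _ fun i => ?_) (measurable_pi_lambda _ fun i => ?_)
  · refine Fin.lastCases ?_ (fun j => ?_) i
    · simpa [nextHist] using measurable_snd
    · simp only [Fin.snoc_castSucc]
      fun_prop
  · fun_prop

end Spaces

section Borel

/-- On a finite discrete space, the weak topology on probability measures is induced by the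
point masses. -/
theorem isInducing_pointMass (A : Type*) [Finite A] [TopologicalSpace A] [DiscreteTopology A]
    [MeasurableSpace A] [BorelSpace A] :
    Topology.IsInducing (fun (μ : ProbabilityMeasure A) (a : A) => μ {a}) := by
  cases nonempty_fintype A
  have hcont : Continuous (fun (μ : ProbabilityMeasure A) (a : A) => μ {a}) := by
    refine continuous_pi fun a => continuous_iff_continuousAt.2 fun μ => ?_
    exact ProbabilityMeasure.tendsto_measure_of_null_frontier_of_tendsto Filter.tendsto_id
      (by simp)
  refine Topology.isInducing_iff_nhds.2 fun μ => le_antisymm hcont.continuousAt.le_comap ?_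
  have key := (ProbabilityMeasure.tendsto_iff_forall_lintegral_tendsto
    (F := (nhds fun a : A => μ {a}).comap fun (μ : ProbabilityMeasure A) (a : A) => μ {a})
    (μs := id) (μ := μ)).2 (fun f => ?_)
  · exact key
  · simp only [lintegral_fintype]
    refine tendsto_finsetSum _ fun a _ => ?_
    refine ENNReal.Tendsto.const_mul ?_ (Or.inr ENNReal.coe_ne_top)
    have h : Filter.Tendsto (fun ν : ProbabilityMeasure A => ν {a})
        ((nhds fun a : A => μ {a}).comap fun (μ : ProbabilityMeasure A) (a : A) => μ {a})
        (nhds (μ {a})) :=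
      ((continuous_apply a).tendsto (fun a : A => μ {a})).comp Filter.tendsto_comap
    simpa using (ENNReal.tendsto_coe.2 h)

theorem borelSpace_probabilityMeasure (A : Type*) [Finite A] [TopologicalSpace A]
    [DiscreteTopology A] [MeasurableSpace A] [BorelSpace A] :
    BorelSpace (ProbabilityMeasure A) := by
  cases nonempty_fintype A
  have hi := isInducing_pointMass A
  refine ⟨le_antisymm ?_ ?_⟩
  · have hm : @Measurable _ _ (borel (ProbabilityMeasure A)) _
        (fun μ : ProbabilityMeasure A => (μ : Measure A)) := by
      refine @Measure.measurable_of_measurable_coe _ _ _ (borel (ProbabilityMeasure A)) _ ?_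
      intro s _
      have hs : ∀ μ : ProbabilityMeasure A, (μ : Measure A) s
          = ∑ a ∈ s.toFinite.toFinset, ((μ {a} : NNReal) : ENNReal) := by
        intro μ
        have := sum_measure_singleton (μ := (μ : Measure A)) (s := s.toFinite.toFinset)
        simpa using this.symm
      simp only [hs]
      let _ : MeasurableSpace (ProbabilityMeasure A) := borel _
      have _ : BorelSpace (ProbabilityMeasure A) := ⟨rfl⟩
      refine Finset.measurable_fun_sum _ fun a _ => ?_
      have : Continuous fun μ : ProbabilityMeasure A => μ {a} :=
        (continuous_apply a).comp hi.continuous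
      exact this.measurable.coe_nnreal_ennreal
    exact hm.comap_le
  · rw [show borel (ProbabilityMeasure A) = @borel _ (TopologicalSpace.induced
        (fun (μ : ProbabilityMeasure A) (a : A) => μ {a}) inferInstance) from
      congrArg (@borel _) hi.eq_induced, borel_comap, ← BorelSpace.measurable_eq (α := A → NNReal)]
    refine Measurable.comap_le ?_
    refine measurable_pi_lambda _ fun a => ?_
    exact ((Measure.measurable_coe (measurableSet_singleton a)).comp
      measurable_subtype_coe).ennreal_toNNReal

/-- The `σ`-algebras used on the spaces of policies and of policy-profiles are the Borel
`σ`-algebras of the topology of pointwise weak convergence. -/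
theorem borelSpace_policy {N : ℕ} (O₀ : Type*) (O A : Fin N → Type*) [Countable O₀]
    [∀ n, Countable (O n)] [∀ n, Finite (A n)] [∀ n, TopologicalSpace (A n)]
    [∀ n, DiscreteTopology (A n)] [∀ n, MeasurableSpace (A n)] [∀ n, BorelSpace (A n)] :
    (∀ n, BorelSpace (Policy O₀ O A n)) ∧ BorelSpace (Profile O₀ O A) := by
  have : ∀ n, BorelSpace (ProbabilityMeasure (A n)) := fun n => borelSpace_probabilityMeasure (A n)
  have : ∀ n, SecondCountableTopology (ProbabilityMeasure (A n)) := fun n => by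
    have : Countable (A n) := Finite.to_countable
    exact (isInducing_pointMass (A n)).secondCountableTopology
  exact ⟨fun n => inferInstance, inferInstance⟩

end Borel

noncomputable section Dynamics

variable {N : ℕ} {S O₀ : Type*} {O A : Fin N → Type*}
  [MeasurableSpace S]
  [MeasurableSpace O₀] [DiscreteMeasurableSpace O₀] [Countable O₀]
  [∀ n, MeasurableSpace (O n)] [∀ n, DiscreteMeasurableSpace (O n)] [∀ n, Countable (O n)]
  [∀ n, MeasurableSpace (A n)] [∀ n, DiscreteMeasurableSpace (A n)] [∀ n, Finite (A n)]

/-- The law of the joint action at time `t` under the profile `u`, given the joint history `h`: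
the agents randomize independently of each other. -/
def decision (t : ℕ) (u : Profile O₀ O A) (h : JointHist O₀ O A t) : Measure (JointAct A) :=
  Measure.pi fun n => (u n t (h.agent n) : Measure (A n))

theorem measurable_decision (t : ℕ) :
    Measurable fun p : Profile O₀ O A × JointHist O₀ O A t => decision t p.1 p.2 := by
  refine measurable_from_prod_countable_left fun h => ?_
  have h1 : ∀ s : Set (JointAct A), MeasurableSet s →
      Measurable fun u : Profile O₀ O A => decision t u h s := by
    intro s _
    have hs : ∀ u : Profile O₀ O A, decision t u h s
        = ∑ a ∈ s.toFinite.toFinset, ∏ n, (u n t (h.agent n) : Measure (A n)) {a n} := by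
      intro u
      have := sum_measure_singleton (μ := decision t u h) (s := s.toFinite.toFinset)
      simp only [Set.Finite.coe_toFinset] at this
      rw [← this]
      exact Finset.sum_congr rfl fun a _ => Measure.pi_singleton _ a
    simp only [hs]
    refine Finset.measurable_fun_sum _ fun a _ => Finset.measurable_fun_prod _ fun n _ => ?_
    refine (Measure.measurable_coe (measurableSet_singleton (a n))).comp
      (measurable_subtype_coe.comp ?_)
    exact (measurable_pi_apply (h.agent n)).comp
      ((measurable_pi_apply t).comp (measurable_pi_apply n))
  exact Measure.measurable_of_measurable_coe _ h1

/-- `decision`, as a kernel in the profile and the joint history. -/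
def decisionKernel (t : ℕ) : Kernel (Profile O₀ O A × JointHist O₀ O A t) (JointAct A) where
  toFun p := decision t p.1 p.2
  measurable' := measurable_decision t

instance (t : ℕ) : IsMarkovKernel (decisionKernel (O₀ := O₀) (O := O) (A := A) t) :=
  ⟨fun p => by change IsProbabilityMeasure (Measure.pi _); infer_instance⟩

/-- The law of the first stage under a profile: the state and the joint observation have law `P₁`,
and the joint action is then drawn according to the profile. -/
def initKernel (P₁ : Measure (S × JointObs O₀ O)) : Kernel (Profile O₀ O A) (Stage S O₀ O A) :=
  ((Kernel.const (Profile O₀ O A) P₁) ⊗ₖ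
    ((decisionKernel (O₀ := O₀) (O := O) (A := A) 0).comap
      (fun q : Profile O₀ O A × (S × JointObs O₀ O) =>
        (q.1, ((fun _ => q.2.2, Fin.elim0) : JointHist O₀ O A 0))) (by fun_prop))).map
    (fun q => (q.1.1, q.1.2, q.2))

/-- The law of the stage at time `t + 1`, given the profile and the stages up to time `t`: the state
and the joint observation are drawn from the transition law at the current state and joint action,
and the joint action is then drawn according to the profile. -/
def stepKernel (Ptr : Kernel (S × JointAct A) (S × JointObs O₀ O)) (t : ℕ) :
    Kernel (Profile O₀ O A × ((i : Finset.Iic t) → Stage S O₀ O A)) (Stage S O₀ O A) :=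
  ((Ptr.comap
      (fun p : Profile O₀ O A × ((i : Finset.Iic t) → Stage S O₀ O A) =>
        ((p.2 ⟨t, Finset.mem_Iic.2 le_rfl⟩).1, (p.2 ⟨t, Finset.mem_Iic.2 le_rfl⟩).2.2))
      (by fun_prop)) ⊗ₖ
    ((decisionKernel (O₀ := O₀) (O := O) (A := A) (t + 1)).comap
      (fun q : (Profile O₀ O A × ((i : Finset.Iic t) → Stage S O₀ O A)) × (S × JointObs O₀ O) =>
        (q.1.1, nextHist q.1.2 q.2.2))
      ((measurable_fst.comp measurable_fst).prodMk ((measurable_nextHist t).comp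
        ((measurable_snd.comp measurable_fst).prodMk
          (measurable_snd.comp measurable_snd)))))).map
    (fun q => (q.1.1, q.1.2, q.2))

instance (P₁ : Measure (S × JointObs O₀ O)) [IsProbabilityMeasure P₁] :
    IsMarkovKernel (initKernel (A := A) P₁) := by
  unfold initKernel
  exact Kernel.IsMarkovKernel.map _ (by fun_prop)

instance (Ptr : Kernel (S × JointAct A) (S × JointObs O₀ O)) [IsMarkovKernel Ptr] (t : ℕ) :
    IsMarkovKernel (stepKernel Ptr t) := by
  unfold stepKernel
  exact Kernel.IsMarkovKernel.map _ (by fun_prop)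

/-- The law of the infinite trajectory under the policy-profile `u` (Ionescu-Tulcea). -/
def trajLaw (P₁ : Measure (S × JointObs O₀ O)) (Ptr : Kernel (S × JointAct A) (S × JointObs O₀ O))
    [IsMarkovKernel Ptr] (u : Profile O₀ O A) : Measure (ℕ → Stage S O₀ O A) :=
  Kernel.trajMeasure (X := fun _ => Stage S O₀ O A) (initKernel P₁ u)
    (fun t => (stepKernel Ptr t).sectR u)

instance (P₁ : Measure (S × JointObs O₀ O)) [IsProbabilityMeasure P₁]
    (Ptr : Kernel (S × JointAct A) (S × JointObs O₀ O)) [IsMarkovKernel Ptr]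
    (u : Profile O₀ O A) : IsProbabilityMeasure (trajLaw P₁ Ptr u) := by
  unfold trajLaw
  infer_instance

theorem measurable_trajLaw (P₁ : Measure (S × JointObs O₀ O)) [IsProbabilityMeasure P₁]
    (Ptr : Kernel (S × JointAct A) (S × JointObs O₀ O)) [IsMarkovKernel Ptr] :
    Measurable fun u : Profile O₀ O A => trajLaw P₁ Ptr u := by
  have hmarg : ∀ n : ℕ, Measurable fun u : Profile O₀ O A =>
      (trajLaw P₁ Ptr u).map
        (Preorder.frestrictLe (π := fun _ : ℕ => Stage S O₀ O A) n) := by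
    intro n
    induction n with
    | zero =>
      have h0 : ∀ u : Profile O₀ O A, (trajLaw P₁ Ptr u).map
          (Preorder.frestrictLe (π := fun _ : ℕ => Stage S O₀ O A) 0) =
          (initKernel P₁ u).map
            (MeasurableEquiv.piUnique fun _ : Finset.Iic 0 => Stage S O₀ O A).symm := by
        intro u
        unfold trajLaw Kernel.trajMeasure
        rw [Measure.map_comp _ _ (by fun_prop), Kernel.traj_map_frestrictLe,
          Kernel.partialTraj_self, Measure.id_comp]
      simp only [h0]
      exact (Measure.measurable_map _ (MeasurableEquiv.measurable _)).comp (Kernel.measurable _)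
    | succ n ih =>
      let g : ((i : Finset.Iic n) → Stage S O₀ O A) × Stage S O₀ O A →
          ((i : Finset.Iic (n + 1)) → Stage S O₀ O A) :=
        fun p i => if hi : (i : ℕ) ≤ n then p.1 ⟨i, Finset.mem_Iic.2 hi⟩ else p.2
      have hg : Measurable g := by
        refine measurable_pi_lambda _ fun i => ?_
        by_cases hi : (i : ℕ) ≤ n
        · simp only [g, hi, dite_true]; fun_prop
        · simp only [g, hi, dite_false]; fun_prop
      let ν : Kernel (Profile O₀ O A) ((i : Finset.Iic n) → Stage S O₀ O A) := ⟨_, ih⟩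
      have : IsMarkovKernel ν := ⟨fun u => Measure.isProbabilityMeasure_map (by fun_prop)⟩
      have hs : ∀ u : Profile O₀ O A, (trajLaw P₁ Ptr u).map
          (Preorder.frestrictLe (π := fun _ : ℕ => Stage S O₀ O A) (n + 1)) =
          ((ν ⊗ₖ stepKernel Ptr n) u).map g := by
        intro u
        rw [Kernel.compProd_apply_eq_compProd_sectR]
        have e : ν u ⊗ₘ (stepKernel Ptr n).sectR u = (trajLaw P₁ Ptr u).map
            (fun x => (Preorder.frestrictLe n x, x (n + 1))) :=
          Kernel.map_frestrictLe_trajMeasure_compProd_eq_map_trajMeasure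
            (X := fun _ => Stage S O₀ O A) (μ₀ := initKernel P₁ u)
            (κ := fun t => (stepKernel Ptr t).sectR u) (a := n)
        rw [e, Measure.map_map hg (by fun_prop)]
        congr 1
        funext x i
        have hi' := Finset.mem_Iic.1 i.2
        by_cases hi : (i : ℕ) ≤ n
        · simp [g, hi]
        · have : (i : ℕ) = n + 1 := by omega
          simp [g, ← this]
      simp only [hs]
      exact (Measure.measurable_map _ hg).comp (Kernel.measurable _)
  refine Measure.measurable_of_measurable_coe _ fun t ht => ?_
  refine MeasurableSpace.induction_on_inter
    (C := fun t _ => Measurable fun u : Profile O₀ O A => trajLaw P₁ Ptr u t)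
    (s := measurableCylinders fun _ : ℕ => Stage S O₀ O A) generateFrom_measurableCylinders.symm
    isPiSystem_measurableCylinders (by simp) (fun t ht => ?_) (fun t mt ht => ?_)
    (fun f disf mf hf => ?_) t ht
  · obtain ⟨n, s, ms, rfl⟩ : ∃ n s, MeasurableSet s ∧ t = cylinder (Finset.Iic n) s := by
      simpa [measurableCylinders_nat] using ht
    have e : ∀ u : Profile O₀ O A, trajLaw P₁ Ptr u (cylinder (Finset.Iic n) s) =
        (trajLaw P₁ Ptr u).map
          (Preorder.frestrictLe (π := fun _ : ℕ => Stage S O₀ O A) n) s := fun u =>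
      (Measure.map_apply (Preorder.measurable_frestrictLe n) ms).symm
    simp only [e]
    exact (Measure.measurable_coe ms).comp (hmarg n)
  · simpa [measure_compl mt (measure_ne_top _ _)] using Measurable.const_sub ht _
  · simpa [measure_iUnion disf mf] using Measurable.tsum hf

/-- `trajLaw`, as a kernel in the policy-profile. -/
def trajKernel (P₁ : Measure (S × JointObs O₀ O)) [IsProbabilityMeasure P₁]
    (Ptr : Kernel (S × JointAct A) (S × JointObs O₀ O)) [IsMarkovKernel Ptr] :
    Kernel (Profile O₀ O A) (ℕ → Stage S O₀ O A) where
  toFun u := trajLaw P₁ Ptr u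
  measurable' := measurable_trajLaw P₁ Ptr

instance (P₁ : Measure (S × JointObs O₀ O)) [IsProbabilityMeasure P₁]
    (Ptr : Kernel (S × JointAct A) (S × JointObs O₀ O)) [IsMarkovKernel Ptr] :
    IsMarkovKernel (trajKernel P₁ Ptr) :=
  ⟨fun u => by change IsProbabilityMeasure (trajLaw P₁ Ptr u); infer_instance⟩

/-- The joint law of the random policy-profile and of the infinite trajectory, when the
policy-profile is drawn from the mixture `μ` before the process starts. -/
def mixtureLaw (P₁ : Measure (S × JointObs O₀ O)) [IsProbabilityMeasure P₁]
    (Ptr : Kernel (S × JointAct A) (S × JointObs O₀ O)) [IsMarkovKernel Ptr]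
    (μ : ProbabilityMeasure (Profile O₀ O A)) :
    Measure (Profile O₀ O A × (ℕ → Stage S O₀ O A)) :=
  (μ : Measure (Profile O₀ O A)) ⊗ₘ trajKernel P₁ Ptr

end Dynamics

noncomputable section Occupation

variable {N : ℕ} {S O₀ : Type*} {O A : Fin N → Type*}

/-- The joint history at time `t` along a trajectory. -/
def histAt (ω : ℕ → Stage S O₀ O A) (t : ℕ) : JointHist O₀ O A t :=
  (fun i => (ω i).2.1, fun i => (ω i).2.2)

/-- The joint action at time `t` along a trajectory. -/
def actAt (ω : ℕ → Stage S O₀ O A) (t : ℕ) : JointAct A := (ω t).2.2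

/-- The type of (infinite-horizon, undiscounted) occupation measures: a mass for every time, every
joint history at that time, and every joint action. -/
abbrev OccMeasure (O₀ : Type*) (O A : Fin N → Type*) :=
  (t : ℕ) → JointHist O₀ O A t → JointAct A → ℝ≥0∞

variable [MeasurableSpace S]
  [MeasurableSpace O₀] [DiscreteMeasurableSpace O₀] [Countable O₀]
  [∀ n, MeasurableSpace (O n)] [∀ n, DiscreteMeasurableSpace (O n)] [∀ n, Countable (O n)]
  [∀ n, MeasurableSpace (A n)] [∀ n, DiscreteMeasurableSpace (A n)] [∀ n, Finite (A n)]

/-- The occupation measure of a policy-profile. -/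
def occProfile (P₁ : Measure (S × JointObs O₀ O))
    (Ptr : Kernel (S × JointAct A) (S × JointObs O₀ O)) [IsMarkovKernel Ptr]
    (u : Profile O₀ O A) : OccMeasure O₀ O A :=
  fun t h a => trajLaw P₁ Ptr u {ω | histAt ω t = h ∧ actAt ω t = a}

/-- The occupation measure of a joint mixture of policy-profiles. -/
def occMixture (P₁ : Measure (S × JointObs O₀ O)) [IsProbabilityMeasure P₁]
    (Ptr : Kernel (S × JointAct A) (S × JointObs O₀ O)) [IsMarkovKernel Ptr]
    (μ : ProbabilityMeasure (Profile O₀ O A)) : OccMeasure O₀ O A :=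
  fun t h a => mixtureLaw P₁ Ptr μ {p | histAt p.2 t = h ∧ actAt p.2 t = a}

/-- The mixture of policy-profiles in which the agents draw their policies independently. -/
def productMixture (μ : ∀ n, ProbabilityMeasure (Policy O₀ O A n)) :
    ProbabilityMeasure (Profile O₀ O A) :=
  ProbabilityMeasure.pi μ

/-- The mixture of policy-profiles in which the agents draw pure policies independently; a
probability measure on pure policies is regarded as one on policies. -/
def pureProductMixture (μ : ∀ n, ProbabilityMeasure (PurePolicy O₀ O A n)) :
    ProbabilityMeasure (Profile O₀ O A) :=
  productMixture fun n => (μ n).map (f := Subtype.val) measurable_subtype_coe.aemeasurable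

end Occupation

end DecPOMDP

/-! Fix a sequence `y` of joint observations and actions. The probability that the process follows
`y` up to time `t` is `c * ∏ n, w n`. Here `c` comes from the environment alone, and `w n` is the
product of the probabilities that agent `n` gives to her own actions along her view of `y`; it
depends on her policy only (`exists_occProfile_eq`). States are hidden, so the induction must carry
the whole law of the current state on this event, not just the probability of the event
(`exists_state_measure`).

Under a product mixture the factors `w n` are independent, so the integral over profiles is again
`c` times a product, now of each agent's mean weight. Equality of occupation measures thus reduces
to one agent at a time: it suffices that her mixture and her policy give equal weight to every
sequence (`occMixture_productMixture_eq`).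

What remains is Kuhn's theorem for a single agent who remembers her own observations and actions.
From a mixture to a behavioral policy, play the conditional law of the next action given that the
recorded actions were taken (`exists_policy_actionWeight_eq`). From a behavioral policy to a mixture
of pure ones, draw an action for every history in advance, independently
(`exists_pure_mixture_actionWeight_eq`). Since pure mixtures are mixtures, the inclusions close into
a cycle. -/

namespace DecPOMDP

/-! ### Histories as prefixes of infinite sequences, and action weights. -/

section Paths

variable {N : ℕ} {O₀ : Type*} {O A : Fin N → Type*}

/-- The joint history at time `t` along a sequence of joint observations and joint actions. -/
def pathHist (y : ℕ → JointObs O₀ O × JointAct A) (t : ℕ) : JointHist O₀ O A t :=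
  (fun i => (y i).1, fun i => (y i).2)

/-- What agent `n` sees of a sequence of joint observations and joint actions. -/
def agentPath (y : ℕ → JointObs O₀ O × JointAct A) (n : Fin N) : ℕ → O₀ × O n × A n :=
  fun i => ((y i).1.1, (y i).1.2 n, (y i).2 n)

/-- The history of agent `n` at time `t` along a sequence of observations and actions. -/
def agentPathHist {n : Fin N} (z : ℕ → O₀ × O n × A n) (t : ℕ) : AgentHist O₀ O A n t :=
  (fun i => (z i).1, fun i => (z i).2.1, fun i => (z i).2.2)

theorem exists_pathHist_eq {t : ℕ} (h : JointHist O₀ O A t) (a : JointAct A) :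
    ∃ y : ℕ → JointObs O₀ O × JointAct A, pathHist y t = h ∧ (y t).2 = a := by
  -- Values after time `t` are padding; only the `else` branch at `i = t` matters, where it records
  -- `a`.
  refine ⟨fun i => (h.1 ⟨min i t, by omega⟩, if hi : i < t then h.2 ⟨i, hi⟩ else a), ?_, by simp⟩
  refine Prod.ext (funext fun i => ?_) (funext fun i => ?_)
  · exact congrArg h.1 (Fin.ext (by simp only; omega))
  · simp [pathHist]

theorem histAt_eq_pathHist_iff {S : Type*} (y : ℕ → JointObs O₀ O × JointAct A) (t : ℕ)
    (ω : ℕ → Stage S O₀ O A) :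
    (histAt ω t = pathHist y t ∧ actAt ω t = (y t).2) ↔ ∀ i ≤ t, (ω i).2 = y i := by
  constructor
  · rintro ⟨h, ha⟩ i hi
    refine Prod.ext (congrFun (congrArg Prod.fst h) ⟨i, by omega⟩) ?_
    rcases hi.lt_or_eq with hi | rfl
    · exact congrFun (congrArg Prod.snd h) ⟨i, hi⟩
    · exact ha
  · intro h
    refine ⟨Prod.ext (funext fun i => ?_) (funext fun i => ?_), congrArg Prod.snd (h t le_rfl)⟩
    · exact congrArg Prod.fst (h i (by omega))
    · exact congrArg Prod.snd (h i (by omega))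

theorem nextHist_eq_pathHist {S : Type*} (y : ℕ → JointObs O₀ O × JointAct A) {t : ℕ}
    {x : (i : Finset.Iic t) → Stage S O₀ O A} (hx : ∀ i, (x i).2 = y i) :
    nextHist x (y (t + 1)).1 = pathHist y (t + 1) := by
  refine Prod.ext (funext fun i => ?_) (funext fun i => ?_)
  · refine Fin.lastCases ?_ (fun j => ?_) i
    · simp [nextHist, pathHist]
    · simp [nextHist, pathHist, hx]
  · simp [nextHist, pathHist, hx]

variable [∀ n, MeasurableSpace (A n)]

/-- The probability with which the policy `u` takes the first `t` actions of `z` when it makes the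
observations of `z`. -/
noncomputable def actionWeight {n : Fin N} (z : ℕ → O₀ × O n × A n) (t : ℕ)
    (u : Policy O₀ O A n) : ℝ≥0∞ :=
  ∏ s ∈ Finset.range t, (u s (agentPathHist z s) : Measure (A n)) {(z s).2.2}

theorem actionWeight_succ {n : Fin N} (z : ℕ → O₀ × O n × A n) (t : ℕ) (u : Policy O₀ O A n) :
    actionWeight z (t + 1) u =
      actionWeight z t u * (u t (agentPathHist z t) : Measure (A n)) {(z t).2.2} :=
  Finset.prod_range_succ _ _

/-- The probability with which the policy `u` takes the actions recorded in a history. -/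
noncomputable def histWeight {n : Fin N} {t : ℕ} (h : AgentHist O₀ O A n t)
    (u : Policy O₀ O A n) : ℝ≥0∞ :=
  ∏ s : Fin t, (u s (fun i => h.1 (i.castLE (by omega)), fun i => h.2.1 (i.castLE (by omega)),
    fun i => h.2.2 (i.castLE (by omega))) : Measure (A n)) {h.2.2 s}

/-- The first `t` decisions involve nothing outside the history at time `t`. This lets a conditional
law be attached to a history rather than to an infinite sequence. -/
theorem histWeight_agentPathHist {n : Fin N} (z : ℕ → O₀ × O n × A n) (t : ℕ) :
    histWeight (agentPathHist z t) = actionWeight z t := by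
  funext u
  rw [actionWeight, Finset.prod_range]
  rfl

theorem measurable_policy_apply {n : Fin N} (t : ℕ) (h : AgentHist O₀ O A n t) (B : Set (A n))
    (hB : MeasurableSet B) :
    Measurable fun u : Policy O₀ O A n => (u t h : Measure (A n)) B :=
  (Measure.measurable_coe hB).comp (measurable_subtype_coe.comp
    ((measurable_pi_apply h).comp (measurable_pi_apply t)))

theorem measurable_policy_toMeasure {n : Fin N} (t : ℕ) (h : AgentHist O₀ O A n t) :
    Measurable fun u : Policy O₀ O A n => (u t h : Measure (A n)) :=
  measurable_subtype_coe.comp ((measurable_pi_apply h).comp (measurable_pi_apply t))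

theorem decision_pathHist_singleton (u : Profile O₀ O A) (y : ℕ → JointObs O₀ O × JointAct A)
    (t : ℕ) : decision t u (pathHist y t) {(y t).2} =
      ∏ n, (u n t (agentPathHist (agentPath y n) t) : Measure (A n)) {(agentPath y n t).2.2} :=
  Measure.pi_singleton _ _

variable [∀ n, DiscreteMeasurableSpace (A n)]

theorem measurable_actionWeight {n : Fin N} (z : ℕ → O₀ × O n × A n) (t : ℕ) :
    Measurable (actionWeight (A := A) z t) :=
  Finset.measurable_fun_prod _ fun _ _ => measurable_policy_apply _ _ _ (measurableSet_singleton _)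

theorem measurable_histWeight {n : Fin N} {t : ℕ} (h : AgentHist O₀ O A n t) :
    Measurable (histWeight h) :=
  Finset.measurable_fun_prod _ fun _ _ => measurable_policy_apply _ _ _ (measurableSet_singleton _)

end Paths

/-! ### Splitting path probabilities into environment and agents. -/

section Factorization

/-- By `hc` the second kernel ignores the hidden coordinate, so its mass leaves the integral as a
constant. It serves both the initial and the transition kernel, because decisions do not look at the
state. -/
theorem compProd_map_assoc_apply {X S Y Z : Type*} [MeasurableSpace X] [MeasurableSpace S]
    [MeasurableSpace Y] [MeasurableSpace Z] [MeasurableSingletonClass Y]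
    [MeasurableSingletonClass Z] (κ : Kernel X (S × Y)) [IsSFiniteKernel κ]
    (η : Kernel (X × (S × Y)) Z) [IsSFiniteKernel η] (x : X) {B : Set S} (hB : MeasurableSet B)
    (o : Y) (a : Z) {c : ℝ≥0∞} (hc : ∀ s, η (x, (s, o)) {a} = c) :
    ((κ ⊗ₖ η).map fun q => (q.1.1, q.1.2, q.2)) x (B ×ˢ {(o, a)}) = κ x (B ×ˢ {o}) * c := by
  have hpre : (fun q : (S × Y) × Z => (q.1.1, q.1.2, q.2)) ⁻¹' (B ×ˢ {(o, a)}) =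
      (B ×ˢ {o}) ×ˢ {a} := by
    ext q
    simp [and_assoc]
  have ho : MeasurableSet (B ×ˢ ({o} : Set Y)) := hB.prod (measurableSet_singleton o)
  rw [Kernel.map_apply' _ (by fun_prop) _ (hB.prod (measurableSet_singleton _)), hpre,
    Kernel.compProd_apply_prod ho (measurableSet_singleton _),
    setLIntegral_congr_fun (g := fun _ => c) ho, setLIntegral_const, mul_comm]
  rintro ⟨s, o'⟩ ⟨-, rfl⟩
  exact hc s

variable {N : ℕ} {S O₀ : Type*} {O A : Fin N → Type*}
  [MeasurableSpace S]
  [MeasurableSpace O₀] [DiscreteMeasurableSpace O₀] [Countable O₀]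
  [∀ n, MeasurableSpace (O n)] [∀ n, DiscreteMeasurableSpace (O n)] [∀ n, Countable (O n)]
  [∀ n, MeasurableSpace (A n)] [∀ n, DiscreteMeasurableSpace (A n)] [∀ n, Finite (A n)]

theorem initKernel_apply (P₁ : Measure (S × JointObs O₀ O)) [IsProbabilityMeasure P₁]
    (u : Profile O₀ O A) (y : ℕ → JointObs O₀ O × JointAct A) {B : Set S} (hB : MeasurableSet B) :
    initKernel P₁ u (B ×ˢ {y 0}) =
      P₁ (B ×ˢ {(y 0).1}) * decision 0 u (pathHist y 0) {(y 0).2} := by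
  refine compProd_map_assoc_apply _ _ u hB (y 0).1 (y 0).2 fun s => ?_
  have h : (fun _ => (y 0).1, Fin.elim0) = pathHist y 0 :=
    Prod.ext (funext fun i => by simp [pathHist]) (funext fun i => i.elim0)
  change decision 0 u (fun _ => (y 0).1, Fin.elim0) {(y 0).2} = _
  rw [h]

theorem stepKernel_apply (Ptr : Kernel (S × JointAct A) (S × JointObs O₀ O)) [IsMarkovKernel Ptr]
    (u : Profile O₀ O A) (y : ℕ → JointObs O₀ O × JointAct A) (t : ℕ)
    {x : (i : Finset.Iic t) → Stage S O₀ O A} (hx : ∀ i, (x i).2 = y i)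
    {B : Set S} (hB : MeasurableSet B) :
    stepKernel Ptr t (u, x) (B ×ˢ {y (t + 1)}) =
      Ptr ((x ⟨t, Finset.mem_Iic.2 le_rfl⟩).1, (y t).2) (B ×ˢ {(y (t + 1)).1}) *
        decision (t + 1) u (pathHist y (t + 1)) {(y (t + 1)).2} := by
  have h2 : (x ⟨t, Finset.mem_Iic.2 le_rfl⟩).2.2 = (y t).2 := by rw [hx]
  have key := compProd_map_assoc_apply (Ptr.comap
      (fun p : Profile O₀ O A × ((i : Finset.Iic t) → Stage S O₀ O A) =>
        ((p.2 ⟨t, Finset.mem_Iic.2 le_rfl⟩).1, (p.2 ⟨t, Finset.mem_Iic.2 le_rfl⟩).2.2))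
      (by fun_prop)) ((decisionKernel (O₀ := O₀) (O := O) (A := A) (t + 1)).comap
      (fun q : (Profile O₀ O A × ((i : Finset.Iic t) → Stage S O₀ O A)) × (S × JointObs O₀ O) =>
        (q.1.1, nextHist q.1.2 q.2.2))
      ((measurable_fst.comp measurable_fst).prodMk ((measurable_nextHist t).comp
        ((measurable_snd.comp measurable_fst).prodMk
          (measurable_snd.comp measurable_snd))))) (u, x) hB (y (t + 1)).1 (y (t + 1)).2
    (c := decision (t + 1) u (pathHist y (t + 1)) {(y (t + 1)).2}) fun s => by
      change decision (t + 1) u (nextHist x (y (t + 1)).1) {(y (t + 1)).2} = _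
      rw [nextHist_eq_pathHist y hx]
  rw [Kernel.comap_apply, h2] at key
  exact key

theorem trajLaw_map_zero (P₁ : Measure (S × JointObs O₀ O)) [IsProbabilityMeasure P₁]
    (Ptr : Kernel (S × JointAct A) (S × JointObs O₀ O)) [IsMarkovKernel Ptr]
    (u : Profile O₀ O A) : (trajLaw P₁ Ptr u).map (fun ω => ω 0) = initKernel P₁ u := by
  have h0 : (trajLaw P₁ Ptr u).map
      (Preorder.frestrictLe (π := fun _ : ℕ => Stage S O₀ O A) 0) =
      (initKernel P₁ u).map
        (MeasurableEquiv.piUnique fun _ : Finset.Iic 0 => Stage S O₀ O A).symm := by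
    unfold trajLaw Kernel.trajMeasure
    rw [Measure.map_comp _ _ (by fun_prop), Kernel.traj_map_frestrictLe,
      Kernel.partialTraj_self, Measure.id_comp]
  have h1 := congrArg (Measure.map (MeasurableEquiv.piUnique
    fun _ : Finset.Iic 0 => Stage S O₀ O A)) h0
  rw [Measure.map_map (by fun_prop) (by fun_prop), Measure.map_map (by fun_prop) (by fun_prop)] at h1
  rw [MeasurableEquiv.self_comp_symm, Measure.map_id] at h1
  exact h1

theorem measurableSet_follows (y : ℕ → JointObs O₀ O × JointAct A) (t : ℕ) :
    MeasurableSet {ω : ℕ → Stage S O₀ O A | ∀ i ≤ t, (ω i).2 = y i} := by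
  simp only [Set.ofPred_forall]
  refine MeasurableSet.iInter fun i => MeasurableSet.iInter fun _ => ?_
  exact (measurable_snd.comp (measurable_pi_apply i)) (measurableSet_singleton (y i))

/-- On the event that the observations and actions follow `y` up to time `t`, the law of the state
splits into the action weights of the agents and a measure that does not depend on the profile. -/
theorem exists_state_measure (P₁ : Measure (S × JointObs O₀ O)) [IsProbabilityMeasure P₁]
    (Ptr : Kernel (S × JointAct A) (S × JointObs O₀ O)) [IsMarkovKernel Ptr]
    (y : ℕ → JointObs O₀ O × JointAct A) (t : ℕ) :
    ∃ E : Measure S, ∀ u : Profile O₀ O A,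
      ((trajLaw P₁ Ptr u).restrict {ω | ∀ i ≤ t, (ω i).2 = y i}).map (fun ω => (ω t).1) =
        (∏ n, actionWeight (agentPath y n) (t + 1) (u n)) • E := by
  induction t with
  | zero =>
    refine ⟨(P₁.restrict (Set.univ ×ˢ {(y 0).1})).map Prod.fst, fun u => Measure.ext fun B hB => ?_⟩
    have hset : (fun ω : ℕ → Stage S O₀ O A => (ω 0).1) ⁻¹' B ∩ {ω | ∀ i ≤ 0, (ω i).2 = y i} =
        (fun ω => ω 0) ⁻¹' (B ×ˢ {y 0}) := by
      ext ω
      simp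
    have hset' : Prod.fst ⁻¹' B ∩ (Set.univ : Set S) ×ˢ {(y 0).1} = B ×ˢ {(y 0).1} := by
      ext p
      simp
    rw [Measure.map_apply (by fun_prop) hB,
      Measure.restrict_apply (hB.preimage (by fun_prop)), hset,
      ← Measure.map_apply (by fun_prop) (hB.prod (measurableSet_singleton _)), trajLaw_map_zero,
      initKernel_apply P₁ u y hB, decision_pathHist_singleton, Measure.smul_apply,
      Measure.map_apply measurable_fst hB, Measure.restrict_apply (hB.preimage measurable_fst),
      hset', smul_eq_mul, mul_comm]
    simp [actionWeight]
  | succ t ih =>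
    obtain ⟨E, hE⟩ := ih
    have hκ : Measurable fun s => Ptr (s, (y t).2) := Ptr.measurable.comp (by fun_prop)
    -- The unnormalized filter update: move the state by the transition law under the action
    -- prescribed by `y`, keep the prescribed observation, forget it. No profile enters.
    refine ⟨((E.bind fun s => Ptr (s, (y t).2)).restrict (Set.univ ×ˢ {(y (t + 1)).1})).map
      Prod.fst, fun u => Measure.ext fun B hB => ?_⟩
    have hBo : MeasurableSet (B ×ˢ {(y (t + 1)).1}) := hB.prod (measurableSet_singleton _)
    have hκB : Measurable fun s => Ptr (s, (y t).2) (B ×ˢ {(y (t + 1)).1}) :=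
      (Measure.measurable_coe hBo).comp hκ
    let G : Set ((i : Finset.Iic t) → Stage S O₀ O A) := {x | ∀ i, (x i).2 = y i}
    have hG : MeasurableSet G := by
      simp only [G, Set.ofPred_forall]
      exact MeasurableSet.iInter fun i =>
        (measurable_snd.comp (measurable_pi_apply i)) (measurableSet_singleton (y i))
    have hGpre : Preorder.frestrictLe (π := fun _ : ℕ => Stage S O₀ O A) t ⁻¹' G =
        {ω | ∀ i ≤ t, (ω i).2 = y i} := by
      ext ω
      simp [G]
    have hset : (fun ω : ℕ → Stage S O₀ O A => (ω (t + 1)).1) ⁻¹' B ∩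
        {ω | ∀ i ≤ t + 1, (ω i).2 = y i} =
        (fun ω => (Preorder.frestrictLe (π := fun _ : ℕ => Stage S O₀ O A) t ω, ω (t + 1))) ⁻¹'
          (G ×ˢ (B ×ˢ {y (t + 1)})) := by
      ext ω
      have hle : (∀ i ≤ t + 1, (ω i).2 = y i) ↔
          (∀ i ≤ t, (ω i).2 = y i) ∧ (ω (t + 1)).2 = y (t + 1) :=
        ⟨fun h => ⟨fun i hi => h i (by omega), h _ le_rfl⟩, fun h i hi =>
          (Nat.le_succ_iff.1 hi).elim (h.1 i) fun hi => hi ▸ h.2⟩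
      simp only [hle, G, Set.mem_inter_iff, Set.mem_preimage, Set.mem_ofPred_eq,
        Set.mem_prod, Set.mem_singleton_iff, Preorder.frestrictLe_apply, Subtype.forall,
        Finset.mem_Iic]
      tauto
    have hset' : Prod.fst ⁻¹' B ∩ (Set.univ : Set S) ×ˢ {(y (t + 1)).1} =
        B ×ˢ {(y (t + 1)).1} := by
      ext p
      simp
    have e : (trajLaw P₁ Ptr u).map
          (Preorder.frestrictLe (π := fun _ : ℕ => Stage S O₀ O A) t) ⊗ₘ
            (stepKernel Ptr t).sectR u =
        (trajLaw P₁ Ptr u).map (fun x => (Preorder.frestrictLe t x, x (t + 1))) :=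
      Kernel.map_frestrictLe_trajMeasure_compProd_eq_map_trajMeasure
        (X := fun _ => Stage S O₀ O A) (μ₀ := initKernel P₁ u)
        (κ := fun t => (stepKernel Ptr t).sectR u) (a := t)
    set D := decision (t + 1) u (pathHist y (t + 1)) {(y (t + 1)).2} with hD
    -- On `G` the joint history is fixed by `y`, so the action probability `D` is constant.
    have hstep : ∀ x ∈ G, (stepKernel Ptr t).sectR u x (B ×ˢ {y (t + 1)}) =
        Ptr ((x ⟨t, Finset.mem_Iic.2 le_rfl⟩).1, (y t).2) (B ×ˢ {(y (t + 1)).1}) * D :=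
      fun x hx => by rw [Kernel.sectR_apply]; exact stepKernel_apply Ptr u y t hx hB
    have hmeas : Measurable fun x : (i : Finset.Iic t) → Stage S O₀ O A =>
        Ptr ((x ⟨t, Finset.mem_Iic.2 le_rfl⟩).1, (y t).2) (B ×ˢ {(y (t + 1)).1}) :=
      hκB.comp (measurable_fst.comp (measurable_pi_apply _))
    have hmeas' : Measurable fun ω : ℕ → Stage S O₀ O A =>
        Ptr ((ω t).1, (y t).2) (B ×ˢ {(y (t + 1)).1}) :=
      hκB.comp (measurable_fst.comp (measurable_pi_apply t))
    -- The integrand sees the trajectory only through its current state, so the induction hypothesis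
    -- applies.
    have hint : ∫⁻ ω in {ω | ∀ i ≤ t, (ω i).2 = y i},
        Ptr ((ω t).1, (y t).2) (B ×ˢ {(y (t + 1)).1}) ∂trajLaw P₁ Ptr u =
        (∏ n, actionWeight (agentPath y n) (t + 1) (u n)) *
          ∫⁻ s, Ptr (s, (y t).2) (B ×ˢ {(y (t + 1)).1}) ∂E := by
      rw [← smul_eq_mul, ← lintegral_smul_measure, ← hE u, lintegral_map hκB (by fun_prop)]
    rw [Measure.map_apply (by fun_prop) hB,
      Measure.restrict_apply (hB.preimage (by fun_prop)), hset,
      ← Measure.map_apply (by fun_prop) (hG.prod (hB.prod (measurableSet_singleton _))), ← e,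
      Measure.compProd_apply_prod hG (hB.prod (measurableSet_singleton _)),
      setLIntegral_congr_fun hG hstep, Measure.restrict_map (by fun_prop) hG, hGpre,
      lintegral_map (hmeas.mul_const D) (by fun_prop)]
    simp only [Preorder.frestrictLe_apply]
    rw [lintegral_mul_const _ hmeas', hint, hD, decision_pathHist_singleton,
      Measure.smul_apply, Measure.map_apply measurable_fst hB,
      Measure.restrict_apply (hB.preimage measurable_fst), hset',
      Measure.bind_apply hBo hκ.aemeasurable, smul_eq_mul]
    simp only [fun n => actionWeight_succ (agentPath y n) (t + 1) (u n)]
    rw [Finset.prod_mul_distrib]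
    ring

theorem exists_occProfile_eq (P₁ : Measure (S × JointObs O₀ O)) [IsProbabilityMeasure P₁]
    (Ptr : Kernel (S × JointAct A) (S × JointObs O₀ O)) [IsMarkovKernel Ptr]
    (y : ℕ → JointObs O₀ O × JointAct A) (t : ℕ) :
    ∃ c : ℝ≥0∞, ∀ u : Profile O₀ O A, occProfile P₁ Ptr u t (pathHist y t) (y t).2 =
      c * ∏ n, actionWeight (agentPath y n) (t + 1) (u n) := by
  obtain ⟨E, hE⟩ := exists_state_measure P₁ Ptr y t
  -- Summing out the hidden state leaves its total mass.
  refine ⟨E Set.univ, fun u => ?_⟩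
  have h := congrArg (fun m => m Set.univ) (hE u)
  simp only [Measure.map_apply (show Measurable fun ω : ℕ → Stage S O₀ O A => (ω t).1 by fun_prop)
    MeasurableSet.univ, Set.preimage_univ, Measure.restrict_apply_univ, Measure.smul_apply,
    smul_eq_mul] at h
  simp only [occProfile, histAt_eq_pathHist_iff]
  rw [h, mul_comm]

theorem occMixture_eq_lintegral (P₁ : Measure (S × JointObs O₀ O)) [IsProbabilityMeasure P₁]
    (Ptr : Kernel (S × JointAct A) (S × JointObs O₀ O)) [IsMarkovKernel Ptr]
    (μ : ProbabilityMeasure (Profile O₀ O A)) (y : ℕ → JointObs O₀ O × JointAct A) (t : ℕ) :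
    occMixture P₁ Ptr μ t (pathHist y t) (y t).2 =
      ∫⁻ u, occProfile P₁ Ptr u t (pathHist y t) (y t).2 ∂(μ : Measure (Profile O₀ O A)) := by
  simp only [occMixture, occProfile, histAt_eq_pathHist_iff]
  exact Measure.compProd_apply (measurable_snd (measurableSet_follows y t))

/-- Functions of distinct coordinates are independent under a product measure. -/
theorem lintegral_pi_prod {ι : Type*} [Fintype ι] {X : ι → Type*} [∀ i, MeasurableSpace (X i)]
    (μ : ∀ i, Measure (X i)) [∀ i, IsProbabilityMeasure (μ i)] {f : ∀ i, X i → ℝ≥0∞}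
    (hf : ∀ i, Measurable (f i)) :
    ∫⁻ x, ∏ i, f i (x i) ∂Measure.pi μ = ∏ i, ∫⁻ x, f i x ∂μ i := by
  refine (lintegral_prod_eq_prod_lintegral_of_indepFun _ (fun i (x : ∀ i, X i) => f i (x i))
    (iIndepFun_pi fun i => (hf i).aemeasurable) fun i => (hf i).comp (measurable_pi_apply i)).trans ?_
  exact Finset.prod_congr rfl fun i _ => (measurePreserving_eval μ i).lintegral_comp (hf i)

/-- A product mixture has the occupation measure of a profile if each agent's mixture takes each
sequence of actions with the same probability as her policy. -/
theorem occMixture_productMixture_eq (P₁ : Measure (S × JointObs O₀ O)) [IsProbabilityMeasure P₁]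
    (Ptr : Kernel (S × JointAct A) (S × JointObs O₀ O)) [IsMarkovKernel Ptr]
    (μ : ∀ n, ProbabilityMeasure (Policy O₀ O A n)) (v : Profile O₀ O A)
    (h : ∀ n z t, ∫⁻ u, actionWeight z t u ∂(μ n : Measure (Policy O₀ O A n)) =
      actionWeight z t (v n)) :
    occMixture P₁ Ptr (productMixture μ) = occProfile P₁ Ptr v := by
  funext t hist a
  obtain ⟨y, rfl, rfl⟩ := exists_pathHist_eq hist a
  obtain ⟨c, hc⟩ := exists_occProfile_eq P₁ Ptr y t
  have hm : Measurable fun u : Profile O₀ O A =>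
      ∏ n, actionWeight (agentPath y n) (t + 1) (u n) :=
    Finset.measurable_fun_prod _ fun n _ =>
      (measurable_actionWeight _ _).comp (measurable_pi_apply n)
  rw [occMixture_eq_lintegral]
  simp only [hc]
  rw [lintegral_const_mul _ hm, productMixture, ProbabilityMeasure.toMeasure_pi,
    lintegral_pi_prod _ fun n => measurable_actionWeight _ _]
  simp only [h]

end Factorization

/-! ### Kuhn's theorem for a single agent. -/

section Realization

variable {N : ℕ} {O₀ : Type*} {O A : Fin N → Type*}
  [∀ n, MeasurableSpace (A n)] {n : Fin N}

/-- The pure policy that follows a choice of an action for each history. -/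
noncomputable def purePolicyOf (f : (i : Σ t, AgentHist O₀ O A n t) → A n) : PurePolicy O₀ O A n :=
  ⟨fun t h => ⟨Measure.dirac (f ⟨t, h⟩), inferInstance⟩, fun t h => ⟨f ⟨t, h⟩, rfl⟩⟩

theorem measurable_purePolicyOf : Measurable (purePolicyOf (O₀ := O₀) (O := O) (A := A) (n := n)) :=
  Measurable.subtype_mk (measurable_pi_lambda _ fun _ => measurable_pi_lambda _ fun _ =>
    Measurable.subtype_mk (Measure.measurable_dirac.comp (measurable_pi_apply _)))

variable [∀ n, DiscreteMeasurableSpace (A n)]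

/-- The joint law of following the history `h` and of the next action, when the policy is drawn
from the mixture `μ`. -/
noncomputable def mixedDecision (μ : ProbabilityMeasure (Policy O₀ O A n)) {t : ℕ}
    (h : AgentHist O₀ O A n t) : Measure (A n) :=
  ((μ : Measure (Policy O₀ O A n)).withDensity (histWeight h)).bind
    fun u => (u t h : Measure (A n))

theorem mixedDecision_apply (μ : ProbabilityMeasure (Policy O₀ O A n)) {t : ℕ}
    (h : AgentHist O₀ O A n t) {B : Set (A n)} (hB : MeasurableSet B) :
    mixedDecision μ h B = ∫⁻ u, histWeight h u * (u t h : Measure (A n)) B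
      ∂(μ : Measure (Policy O₀ O A n)) := by
  rw [mixedDecision, Measure.bind_apply hB (measurable_policy_toMeasure t h).aemeasurable,
    lintegral_withDensity_eq_lintegral_mul _ (measurable_histWeight h)
      (measurable_policy_apply t h B hB)]
  rfl

theorem mixedDecision_univ (μ : ProbabilityMeasure (Policy O₀ O A n)) {t : ℕ}
    (h : AgentHist O₀ O A n t) :
    mixedDecision μ h Set.univ = ∫⁻ u, histWeight h u ∂(μ : Measure (Policy O₀ O A n)) := by
  simp [mixedDecision_apply μ h MeasurableSet.univ]

instance (μ : ProbabilityMeasure (Policy O₀ O A n)) {t : ℕ} (h : AgentHist O₀ O A n t) :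
    IsFiniteMeasure (mixedDecision μ h) := by
  refine ⟨?_⟩
  rw [mixedDecision_univ]
  calc ∫⁻ u, histWeight h u ∂(μ : Measure (Policy O₀ O A n))
      ≤ ∫⁻ _, 1 ∂(μ : Measure (Policy O₀ O A n)) :=
        lintegral_mono fun u => Finset.prod_le_one' fun _ _ => prob_le_one
    _ < ∞ := by simp

/-- Normalize `M`; if `M` is zero, any probability measure works. The multiplicative form covers
histories that the mixture never follows without a case split later. -/
theorem exists_probabilityMeasure_eq_mass_mul {X : Type*} [MeasurableSpace X]
    [Nonempty (ProbabilityMeasure X)] (M : Measure X) [IsFiniteMeasure M] :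
    ∃ p : ProbabilityMeasure X, ∀ B, M B = M Set.univ * (p : Measure X) B := by
  by_cases hM : M = 0
  · exact ⟨Classical.arbitrary _, by simp [hM]⟩
  · have : NeZero M := ⟨hM⟩
    refine ⟨⟨(M Set.univ)⁻¹ • M, inferInstance⟩, fun B => ?_⟩
    rw [ProbabilityMeasure.coe_mk, Measure.smul_apply, smul_eq_mul, ← mul_assoc,
      ENNReal.mul_inv_cancel (by simpa using hM) (measure_ne_top _ _), one_mul]

/-- Kuhn's theorem: a mixture of policies takes actions like a behavioral policy. -/
theorem exists_policy_actionWeight_eq (μ : ProbabilityMeasure (Policy O₀ O A n)) :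
    ∃ v : Policy O₀ O A n, ∀ z t,
      ∫⁻ u, actionWeight z t u ∂(μ : Measure (Policy O₀ O A n)) = actionWeight z t v := by
  -- A probability measure lives on a nonempty space; `u₀` then shows that laws on actions exist, as
  -- needed at histories of weight zero.
  obtain ⟨u₀⟩ : Nonempty (Policy O₀ O A n) := ProbabilityMeasure.nonempty μ
  have hex : ∀ t (h : AgentHist O₀ O A n t), ∃ p : ProbabilityMeasure (A n), ∀ B,
      mixedDecision μ h B = mixedDecision μ h Set.univ * (p : Measure (A n)) B := fun t h =>
    have : Nonempty (ProbabilityMeasure (A n)) := ⟨u₀ t h⟩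
    exists_probabilityMeasure_eq_mass_mul _
  choose v hv using hex
  refine ⟨v, fun z t => ?_⟩
  induction t with
  | zero => simp [actionWeight]
  | succ t ih =>
    -- Chain rule: the mean weight of the past times the conditional probability of the next action
    -- is the mean weight of both, by the choice of `v`.
    rw [actionWeight_succ, ← ih, ← histWeight_agentPathHist z t, ← mixedDecision_univ, ← hv,
      mixedDecision_apply μ _ (measurableSet_singleton _)]
    simp only [actionWeight_succ, histWeight_agentPathHist]

/-- Each factor is 0 or 1, so the product tests whether the plan `f` agrees with `z` at all the
times before `t`. -/
theorem actionWeight_purePolicyOf (z : ℕ → O₀ × O n × A n) (t : ℕ)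
    (f : (i : Σ t, AgentHist O₀ O A n t) → A n) :
    actionWeight z t (purePolicyOf f).1 =
      Set.indicator {f | ∀ s < t, f ⟨s, agentPathHist z s⟩ = (z s).2.2} 1 f := by
  classical
  have h : ∀ s, (((purePolicyOf f).1 s (agentPathHist z s) : Measure (A n)) {(z s).2.2}) =
      if f ⟨s, agentPathHist z s⟩ = (z s).2.2 then 1 else 0 := fun s => by
    simp [purePolicyOf, Set.indicator_apply]
  simp only [actionWeight, h, Finset.prod_ite_zero, Set.indicator_apply, Finset.mem_range,
    Set.mem_ofPred_eq, Finset.prod_const_one, Pi.one_apply]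

theorem exists_pure_mixture_actionWeight_eq (v : Policy O₀ O A n) :
    ∃ μ : ProbabilityMeasure (PurePolicy O₀ O A n), ∀ z t,
      ∫⁻ u, actionWeight z t u.1 ∂(μ : Measure (PurePolicy O₀ O A n)) = actionWeight z t v := by
  classical
  let m : (i : Σ t, AgentHist O₀ O A n t) → Measure (A n) := fun i => v i.1 i.2
  have : ∀ i, IsProbabilityMeasure (m i) := fun i => inferInstanceAs
    (IsProbabilityMeasure (v i.1 i.2 : Measure (A n)))
  refine ⟨⟨(Measure.infinitePi m).map purePolicyOf,
    Measure.isProbabilityMeasure_map measurable_purePolicyOf.aemeasurable⟩, fun z t => ?_⟩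
  -- The histories along `z` carry different times, hence are distinct coordinates; under the
  -- product measure the choices made there are independent.
  let e : ℕ ↪ Σ t, AgentHist O₀ O A n t :=
    ⟨fun s => ⟨s, agentPathHist z s⟩, fun s s' h => congrArg Sigma.fst h⟩
  have hset : {f : (i : Σ t, AgentHist O₀ O A n t) → A n |
      ∀ s < t, f ⟨s, agentPathHist z s⟩ = (z s).2.2} =
      Set.pi ((Finset.range t).map e) fun i => {(z i.1).2.2} := by
    ext f
    simp only [Set.mem_pi, Finset.coe_map, Set.forall_mem_image, Finset.coe_range, Set.mem_Iio,
      Set.mem_singleton_iff, Set.mem_ofPred_eq]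
    rfl
  have hmeas : MeasurableSet {f : (i : Σ t, AgentHist O₀ O A n t) → A n |
      ∀ s < t, f ⟨s, agentPathHist z s⟩ = (z s).2.2} := by
    rw [hset]
    exact MeasurableSet.pi (Finset.countable_toSet _) fun _ _ => measurableSet_singleton _
  rw [ProbabilityMeasure.coe_mk, lintegral_map (f := fun u : PurePolicy O₀ O A n => actionWeight z t u.1)
    ((measurable_actionWeight z t).comp measurable_subtype_coe) measurable_purePolicyOf]
  simp only [actionWeight_purePolicyOf]
  rw [lintegral_indicator_one hmeas, hset,
    Measure.infinitePi_pi _ fun _ _ => measurableSet_singleton _, Finset.prod_map]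
  rfl

end Realization

end DecPOMDP
theorem mainTheorem3 {N : ℕ} {S O₀ : Type*} {O A : Fin N → Type*}
    [MeasurableSpace S]
    [MeasurableSpace O₀] [DiscreteMeasurableSpace O₀] [Countable O₀]
    [∀ n, MeasurableSpace (O n)] [∀ n, DiscreteMeasurableSpace (O n)] [∀ n, Countable (O n)]
    [∀ n, MeasurableSpace (A n)] [∀ n, DiscreteMeasurableSpace (A n)] [∀ n, Finite (A n)]
    (P₁ : Measure (S × DecPOMDP.JointObs O₀ O)) [IsProbabilityMeasure P₁]
    (Ptr : Kernel (S × DecPOMDP.JointAct A) (S × DecPOMDP.JointObs O₀ O)) [IsMarkovKernel Ptr] :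
    Set.range (fun u : DecPOMDP.Profile O₀ O A => DecPOMDP.occProfile P₁ Ptr u) =
        Set.range (fun μ : ∀ n, ProbabilityMeasure (DecPOMDP.Policy O₀ O A n) =>
          DecPOMDP.occMixture P₁ Ptr (DecPOMDP.productMixture μ)) ∧
      Set.range (fun μ : ∀ n, ProbabilityMeasure (DecPOMDP.Policy O₀ O A n) =>
          DecPOMDP.occMixture P₁ Ptr (DecPOMDP.productMixture μ)) =
        Set.range (fun μ : ∀ n, ProbabilityMeasure (DecPOMDP.PurePolicy O₀ O A n) =>
          DecPOMDP.occMixture P₁ Ptr (DecPOMDP.pureProductMixture μ)) := by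
  have hpb : Set.range (fun μ : ∀ n, ProbabilityMeasure (DecPOMDP.Policy O₀ O A n) =>
      DecPOMDP.occMixture P₁ Ptr (DecPOMDP.productMixture μ)) ⊆
      Set.range (fun u : DecPOMDP.Profile O₀ O A => DecPOMDP.occProfile P₁ Ptr u) := by
    rintro _ ⟨μ, rfl⟩
    choose v hv using fun n => DecPOMDP.exists_policy_actionWeight_eq (μ n)
    exact ⟨v, (DecPOMDP.occMixture_productMixture_eq P₁ Ptr μ v hv).symm⟩
  have hbp : Set.range (fun u : DecPOMDP.Profile O₀ O A => DecPOMDP.occProfile P₁ Ptr u) ⊆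
      Set.range (fun μ : ∀ n, ProbabilityMeasure (DecPOMDP.PurePolicy O₀ O A n) =>
        DecPOMDP.occMixture P₁ Ptr (DecPOMDP.pureProductMixture μ)) := by
    rintro _ ⟨v, rfl⟩
    choose μ hμ using fun n => DecPOMDP.exists_pure_mixture_actionWeight_eq (v n)
    refine ⟨μ, DecPOMDP.occMixture_productMixture_eq P₁ Ptr _ v fun n z t => ?_⟩
    rw [ProbabilityMeasure.toMeasure_map,
      lintegral_map (DecPOMDP.measurable_actionWeight z t) measurable_subtype_coe]
    exact hμ n z t
  have hsub : Set.range (fun μ : ∀ n, ProbabilityMeasure (DecPOMDP.PurePolicy O₀ O A n) =>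
        DecPOMDP.occMixture P₁ Ptr (DecPOMDP.pureProductMixture μ)) ⊆
      Set.range (fun μ : ∀ n, ProbabilityMeasure (DecPOMDP.Policy O₀ O A n) =>
        DecPOMDP.occMixture P₁ Ptr (DecPOMDP.productMixture μ)) := by
    -- A pure mixture is by definition the product mixture of the pushforwards.
    rintro _ ⟨μ, rfl⟩
    exact ⟨_, rfl⟩
  exact ⟨(hbp.trans hsub).antisymm hpb, (hpb.trans hbp).antisymm hsub⟩
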